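/- **Definitions.** A *bimodal map* is a continuous map $f:[c_0,c_3]\to[c_0,c_3]$ with points $c_0<c_1<c_2<c_3$ such that $f$ is strictly increasing on $[c_0,c_1]$ and on $[c_2,c_3]$ and strictly decreasing on $[c_1,c_2]$. The symbol of a point $x$ is $L,A,M,B,R$ according to $x<c_1$, $x=c_1$, $c_1<x<c_2$, $x=c_2$, $x>c_2$. Conjugation of symbols is $\overline L=R$, $\overline R=L$, $\overline M=M$, $\overline A=B$, $\overline B=A$. Let $p\ge 1$ and let $\tilde P=\tilde P_1\cdots\tilde P_{p-1}$ be a word in $\{L,M,R\}$. The set $\mathcal D$ consists of the symmetric kneading data $S=(\tilde P A,\overline{\tilde P}B)$ (two periodic orbits) and $S=\tilde P B\,\overline{\tilde P}A$ (one periodic orbit through both turning points) that are realized by some bimodal map $f$, i.e. the symbols of $f(c_1),f^2(c_1),\dots$ form the periodic sequence with block $\tilde PA$, respectively $\tilde PB\overline{\tilde P}A$, and the symbols of $f(c_2),f^2(c_2),\dots$ form the conjugate sequence. Symbol sequences are ordered lexicographically by the signed symbols $\theta_j=\big(\prod_{i<j}\epsilon(S_i)\big)S_j$, where $\epsilon(L)=\epsilon(R)=1$,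 $\epsilon(M)=-1$, $\epsilon(A)=\epsilon(B)=0$ and $-R<-B<-M<-A<-L<0<L<A<M<B<R$. The set $\mathcal D_1$ consists of the $S\in\mathcal D$ whose first component (the sequence of $c_1$) lies between $M^\infty$ and $RM^\infty$. A *unimodal map* is a continuous self-map $g$ of an interval $[b_0,b_1]$ that is strictly increasing on $[b_0,c]$ and strictly decreasing on $[c,b_1]$ for some $b_0<c<b_1$; a point has symbol $\ell,c,r$ according to whether it is left of, equal to, or right of $c$. $\mathcal T_{KS}$ is the set of blocks $Pc$, $P$ a word in $\{\ell,r\}$, such that for some unimodal map $g$ the symbols of $g(c),g^2(c),\dots$ form the periodic sequence with block $Pc$. To $S\in\mathcal D_1$ with word $\tilde P$ corresponds the block $Pc$, where $P$ is obtained from $\tilde P$ by replacing $M$ by $\ell$ and both $L$ and $R$ by $r$. If $z_1<\dots<z_{m+1}$ are the points of the orbits of the turning points (including the turning points) of a map realizing given data, the Markov matrix of the data is the $m\times m$ matrix with entry $(i,j)$ equal to $1$ if $f([z_i,z_{i+1}])\supseteq[z_j,z_{j+1}]$ and to $0$ otherwise. **Proposition 1.** Let $S\in\mathcal D_1$, given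 by a word $\tilde P$ of length $p-1$, and let $Pc$ be the corresponding unimodal block. Then: 1. $Pc\in\mathcal T_{KS}$. 2. The Markov matrices $A_S$, of size $2p-1$, and $A_P$, of size $p-1$, are well defined, that is, each is the same for all maps realizing the data. Order the intervals $I_i=[z_i,z_{i+1}]$, $1\le i\le 2p-1$, of a map realizing $S$ as $I_p;\ I_{p-1},\dots,I_1;\ I_{p+1},\dots,I_{2p-1}$. In this order $$A_S=\begin{bmatrix}1&W_1&W_2\\0&0&A_P\\0&A_P&0\end{bmatrix}$$ for some $1\times(p-1)$ matrices $W_1,W_2$. If $p\ge2$, then $W_1\neq0$ and $W_2\neq0$; so the middle interval $I_p$ has a transition to itself, no other interval has a transition to it, and it has transitions into both other blocks (it is a transient state). 3. For every bimodal map $f$ realizing $S$, $\{z_1,\dots,z_p\}=\{f^{2j}(c_1)\}_{j\ge0}\cup\{f^{2j+1}(c_2)\}_{j\ge0}$ and $\{z_{p+1},\dots,z_{2p}\}=\{f^{2j+1}(c_1)\}_{j\ge0}\cup\{f^{2j}(c_2)\}_{j\ge0}$. Thus the two copies of $A_P$ describe the transitions between the intervals spanned by these two sets of points. -/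

import Mathlib

namespace SymBimodal

/-! ### Symbols and sequences -/

/-- The five symbols recording the position of a point relative to the two turning points. -/
inductive Sym
  | L | A | M | B | R

/-- The three laps (the symbols that are not turning points). -/
inductive Lap
  | L | M | R

/-- A lap regarded as a symbol. -/
def Lap.toSym : Lap → Sym
  | .L => .L
  | .M => .M
  | .R => .R

/-- The conjugation (bar): `L ↔ R`, `A ↔ B`, `M ↔ M`. -/
def Sym.conj : Sym → Sym
  | .L => .R
  | .A => .B
  | .M => .M
  | .B => .A
  | .R => .L

/-- `ε(L) = ε(R) = 1`, `ε(M) = -1`, `ε(A) = ε(B) = 0`. -/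
def Sym.eps : Sym → ℤ
  | .L => 1
  | .A => 0
  | .M => -1
  | .B => 0
  | .R => 1

/-- Position of a symbol, with `A` the midpoint of `L`, `M` and `B` the midpoint of `M`, `R`. The
signed values realize the order `-R < -B < -M < -A < -L < 0 < L < A < M < B < R`. -/
def Sym.val : Sym → ℤ
  | .L => 1
  | .A => 2
  | .M => 3
  | .B => 4
  | .R => 5

/-- The invariant coordinate `θ_j = (∏_{i<j} ε(s_i)) s_j` of a symbol sequence. -/
def theta (s : ℕ → Sym) (j : ℕ) : ℤ :=
  (∏ i ∈ Finset.range j, (s i).eps) * (s j).val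

/-- The order of symbol sequences: lexicographic order of the invariant coordinates. -/
def SeqLT (s t : ℕ → Sym) : Prop :=
  ∃ j, (∀ i < j, theta s i = theta t i) ∧ theta s j < theta t j

/-- The sequence `M^∞`. -/
def seqM : ℕ → Sym := fun _ => .M

/-- The sequence `R M^∞`. -/
def seqRM : ℕ → Sym := fun i => if i = 0 then .R else .M

/-! ### Symmetric kneading data -/

/-- Symmetric kneading data with periodic turning points, given by a block `P = P₁ … P_{p-1}` of
laps: `pair P` is the pair of orbits `(P A, P̄ B)`, and `doubly P` is the single orbit
`P B P̄ A` through both turning points. -/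
inductive Data
  | pair (P : List Lap)
  | doubly (P : List Lap)

/-- The block `P₁ … P_{p-1}`. -/
def Data.word : Data → List Lap
  | .pair P => P
  | .doubly P => P

/-- The periodic block of the kneading sequence of the first turning point. -/
def Data.block : Data → List Sym
  | .pair P => P.map Lap.toSym ++ [.A]
  | .doubly P => P.map Lap.toSym ++ [.B] ++ P.map (fun X => X.toSym.conj) ++ [.A]

/-- The kneading sequence `S₁ S₂ S₃ …` of the first turning point (`S.seq i = S_{i+1}`): the
periodic repetition of the block. -/
def Data.seq (S : Data) (i : ℕ) : Sym :=
  S.block.getD (i % S.block.length) .A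

/-! ### Bimodal maps -/

/-- `f` is a bimodal map of `[c₀, c₃]` into itself with turning points `c₁ < c₂`. -/
structure IsBimodal (f : ℝ → ℝ) (c₀ c₁ c₂ c₃ : ℝ) : Prop where
  lt₀₁ : c₀ < c₁
  lt₁₂ : c₁ < c₂
  lt₂₃ : c₂ < c₃
  mapsTo : Set.MapsTo f (Set.Icc c₀ c₃) (Set.Icc c₀ c₃)
  continuousOn : ContinuousOn f (Set.Icc c₀ c₃)
  incr_left : StrictMonoOn f (Set.Icc c₀ c₁)
  decr_middle : StrictAntiOn f (Set.Icc c₁ c₂)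
  incr_right : StrictMonoOn f (Set.Icc c₂ c₃)

open Classical in
/-- The symbol of a point `x` relative to `c₁ < c₂`. -/
noncomputable def address (c₁ c₂ x : ℝ) : Sym :=
  if x < c₁ then .L else if x = c₁ then .A else if x < c₂ then .M else if x = c₂ then .B else .R

/-- `f` is a bimodal map with kneading data `S`: the itinerary of `f(c₁)` is the sequence of `S`,
and the itinerary of `f(c₂)` is the conjugate sequence. The map is not required to be odd. -/
def Data.RealizedBy (S : Data) (f : ℝ → ℝ) (c₀ c₁ c₂ c₃ : ℝ) : Prop :=
  IsBimodal f c₀ c₁ c₂ c₃ ∧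
    ∀ j : ℕ, address c₁ c₂ (f^[j + 1] c₁) = S.seq j ∧
      address c₁ c₂ (f^[j + 1] c₂) = (S.seq j).conj

/-- The set `𝒟` of realizable symmetric kneading data. -/
def setD : Set Data :=
  {S | ∃ (f : ℝ → ℝ) (c₀ c₁ c₂ c₃ : ℝ), S.RealizedBy f c₀ c₁ c₂ c₃}

/-- The set `𝒟₁` of elements of `𝒟` between `(M^∞, M^∞)` and `(R M^∞, L M^∞)`; symmetric data are
ordered by their first components. -/
def setD₁ : Set Data :=
  {S | S ∈ setD ∧ SeqLT seqM S.seq ∧ SeqLT S.seq seqRM}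

/-! ### Unimodal maps -/

/-- The symbols of unimodal dynamics: left of, at, and right of the turning point. -/
inductive USym
  | l | c | r

/-- The two laps of a unimodal map. -/
inductive ULap
  | l | r

/-- A unimodal lap regarded as a symbol. -/
def ULap.toUSym : ULap → USym
  | .l => .l
  | .r => .r

/-- `g` is a unimodal map of `[b₀, b₁]` into itself with its maximum at `c`. -/
structure IsUnimodal (g : ℝ → ℝ) (b₀ c b₁ : ℝ) : Prop where
  lt_left : b₀ < c
  lt_right : c < b₁
  mapsTo : Set.MapsTo g (Set.Icc b₀ b₁) (Set.Icc b₀ b₁)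
  continuousOn : ContinuousOn g (Set.Icc b₀ b₁)
  incr_left : StrictMonoOn g (Set.Icc b₀ c)
  decr_right : StrictAntiOn g (Set.Icc c b₁)

open Classical in
/-- The symbol of a point `x` relative to the turning point `c`. -/
noncomputable def uaddress (c x : ℝ) : USym :=
  if x < c then .l else if x = c then .c else .r

/-- The periodic sequence with block `P c`. -/
def useq (P : List ULap) (i : ℕ) : USym :=
  (P.map ULap.toUSym ++ [USym.c]).getD (i % (P.length + 1)) USym.c

/-- `g` is a unimodal map whose turning point is periodic with kneading sequence `(P c)^∞`. -/
def URealizedBy (P : List ULap) (g : ℝ → ℝ) (b₀ c b₁ : ℝ) : Prop :=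
  IsUnimodal g b₀ c b₁ ∧ ∀ j : ℕ, uaddress c (g^[j + 1] c) = useq P j

/-- The set `𝒯_KS` of unimodal kneading sequences `P c` (recorded by the block `P`). -/
def setT : Set (List ULap) :=
  {P | ∃ (g : ℝ → ℝ) (b₀ c b₁ : ℝ), URealizedBy P g b₀ c b₁}

/-- The correspondence of symbols: `M` corresponds to `l`, and both `L` and `R` to `r`. -/
def Lap.toULap : Lap → ULap
  | .L => .r
  | .M => .l
  | .R => .r

/-- The block of the unimodal kneading sequence that corresponds to `S`. -/
def Data.unimodal (S : Data) : List ULap := S.word.map Lap.toULap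

/-! ### Markov matrices -/

/-- `z 0 < z 1 < … < z m` is the increasing enumeration of the set `X`. -/
def IsEnumeration {m : ℕ} (z : Fin (m + 1) → ℝ) (X : Set ℝ) : Prop :=
  StrictMono z ∧ Set.range z = X

open Classical in
/-- The transition matrix of `f` for the intervals `I_i = [z i, z (i + 1)]`: the entry `(i, j)` is
`1` if `f(I_i) ⊇ I_j`, and `0` otherwise. -/
noncomputable def transitionMatrix {m : ℕ} (f : ℝ → ℝ) (z : Fin (m + 1) → ℝ) :
    Matrix (Fin m) (Fin m) ℤ :=
  Matrix.of fun i j =>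
    if Set.Icc (z j.castSucc) (z j.succ) ⊆ f '' Set.Icc (z i.castSucc) (z i.succ) then 1 else 0

/-- The forward orbit of `x`, including `x`. -/
def orbit (f : ℝ → ℝ) (x : ℝ) : Set ℝ := Set.range fun j : ℕ => f^[j] x

/-- The points `f^j(x)` with `j` even. -/
def evenOrbit (f : ℝ → ℝ) (x : ℝ) : Set ℝ := Set.range fun j : ℕ => f^[2 * j] x

/-- The points `f^j(x)` with `j` odd. -/
def oddOrbit (f : ℝ → ℝ) (x : ℝ) : Set ℝ := Set.range fun j : ℕ => f^[2 * j + 1] x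

/-- `A` is the Markov matrix `A_S` of the realizable data `S`: for every bimodal map with kneading
data `S`, it is the transition matrix of the partition by the points of the two turning orbits. -/
def Data.IsMarkovMatrix (S : Data) {m : ℕ} (A : Matrix (Fin m) (Fin m) ℤ) : Prop :=
  S ∈ setD ∧ ∀ (f : ℝ → ℝ) (c₀ c₁ c₂ c₃ : ℝ), S.RealizedBy f c₀ c₁ c₂ c₃ →
    ∃ z : Fin (m + 1) → ℝ, IsEnumeration z (orbit f c₁ ∪ orbit f c₂) ∧ A = transitionMatrix f z

/-- `A` is the Markov matrix `A_P` of the unimodal kneading sequence `P c`: for every unimodal map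
with this kneading sequence, it is the transition matrix of the partition by the points of the
turning orbit. -/
def UIsMarkovMatrix (P : List ULap) {m : ℕ} (A : Matrix (Fin m) (Fin m) ℤ) : Prop :=
  P ∈ setT ∧ ∀ (g : ℝ → ℝ) (b₀ c b₁ : ℝ), URealizedBy P g b₀ c b₁ →
    ∃ w : Fin (m + 1) → ℝ, IsEnumeration w (orbit g c) ∧ A = transitionMatrix g w

/-- The position, in the left-to-right order, of each state of the block decomposition. -/
def blockIndex (n : ℕ) : Unit ⊕ (Fin n ⊕ Fin n) → Fin (2 * n + 1)
  | .inl _ => ⟨n, by omega⟩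
  | .inr (.inl i) => ⟨n - 1 - i, by omega⟩
  | .inr (.inr i) => ⟨n + 1 + i, by omega⟩

theorem blockIndex_bijective (n : ℕ) : Function.Bijective (blockIndex n) := by
  rw [Fintype.bijective_iff_injective_and_card]
  constructor
  · rintro (_ | a | a) (_ | b | b) h <;> simp only [blockIndex, Fin.mk.injEq] at h
    · rfl
    · have := b.isLt; omega
    · omega
    · have := a.isLt; omega
    · have : a = b := by
        ext
        have := a.isLt
        have := b.isLt
        omega
      rw [this]
    · have := a.isLt; omega
    · omega
    · have := b.isLt; omega
    · have : a = b := by ext; omega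
      rw [this]
  · simp only [Fintype.card_sum, Fintype.card_unit, Fintype.card_fin]; omega

/-- The reordering of the `2 n + 1` intervals: first the middle one, then the `n` intervals to its
left (enumerated from right to left), then the `n` intervals to its right (from left to right). -/
noncomputable def blockEquiv (n : ℕ) : Unit ⊕ (Fin n ⊕ Fin n) ≃ Fin (2 * n + 1) :=
  Equiv.ofBijective (blockIndex n) (blockIndex_bijective n)

end SymBimodal

namespace SymBimodal

/-! ### Families of points ordered by a unimodal kneading sequence -/

/-! The condition `M^∞ < S < RM^∞` says that a realizing map has a fixed point `q` in its middle lap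
with `f(f(c₁)) < q < f(c₁)` and, by reflection, `f(c₂) < q < f(f(c₂))`. Hence `f` exchanges `[f(c₂),
q)` and `(q, f(c₁)]`. The turning orbits split accordingly: the points `f^k(c₂)` with `k` even and
`f^k(c₁)` with `k` odd lie to the right of `q`, the others to the left
(`Data.RealizedBy.exists_isFolded`).

Reflect the left half. The exchange then becomes a unimodal folding: the middle lap, where `f`
decreases, turns into the increasing lap `l`, and the outer laps turn into the decreasing lap `r`.
Both halves have turning sequence `(Pc)^∞`. `IsFolded` records this situation. In such a family the
order of the points depends only on `P` (`IsFolded.lt_iff`): points on different sides of the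
turning point are compared by their symbols, points on the same side by their successors, and
periodicity ends the recursion. So both halves, and the turning orbit of any unimodal map realizing
`Pc`, share one enumeration `κ` and one map `τ` of ranks (`IsFolded.exists_enumeration`).

The matrices are then combinatorial: `A_P` is `coverMatrix τ`, `A_S` is `coverMatrix (swapMap τ)`,
and the block form is `coverMatrix_swapMap`. A unimodal map realizing `Pc` is obtained by following
`-f` on `[q, f(c₁)]` with a monotone homeomorphism onto its image that carries the reflected left
half to the right half. -/

theorem uaddress_eq_l_iff {c x : ℝ} : uaddress c x = .l ↔ x < c := by
  unfold uaddress; split_ifs <;> simp_all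

theorem uaddress_eq_c_iff {c x : ℝ} : uaddress c x = .c ↔ x = c := by
  unfold uaddress; split_ifs <;> simp_all; rintro rfl; simp_all

theorem uaddress_eq_r_iff {c x : ℝ} : uaddress c x = .r ↔ c < x := by
  unfold uaddress
  split_ifs with h h'
  · simp [h.le]
  · simp [h']
  · simpa using lt_of_le_of_ne (not_lt.1 h) (Ne.symm h')

theorem uaddress_self (c : ℝ) : uaddress c c = .c := uaddress_eq_c_iff.2 rfl

theorem useq_eq_c_of_dvd (P : List ULap) {k : ℕ} (h : P.length + 1 ∣ k + 1) :
    useq P k = .c := by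
  have : k % (P.length + 1) = P.length := by
    obtain ⟨d, hd⟩ := h
    obtain ⟨e, rfl⟩ : ∃ e, d = e + 1 := ⟨d - 1, by rcases d with _ | d <;> simp_all⟩
    have : k = P.length + (P.length + 1) * e := by rw [mul_add] at hd; omega
    rw [this, Nat.add_mul_mod_self_left]
    exact Nat.mod_eq_of_lt (by omega)
  simp [useq, this]

theorem useq_ne_c (P : List ULap) {k : ℕ} (h : k < P.length) : useq P k ≠ .c := by
  have h' : k % (P.length + 1) = k := Nat.mod_eq_of_lt (by omega)
  simp only [useq, h']
  rw [List.getD_eq_getElem _ _ (by simp; omega), List.getElem_append_left (by simpa using h),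
    List.getElem_map]
  cases P[k] <;> simp [ULap.toUSym]

/-- Two sequences of points, exchanged by a unimodal folding, whose positions relative to their
initial points are given by the kneading sequence with block `P c`. -/
structure IsFolded (P : List ULap) (r : Bool → ℕ → ℝ) : Prop where
  addr : ∀ a k, uaddress (r a 0) (r a (k + 1)) = useq P k
  left : ∀ a i j, r a i ≤ r a 0 → r a j ≤ r a 0 →
    (r a i < r a j ↔ r (!a) (i + 1) < r (!a) (j + 1))
  right : ∀ a i j, r a 0 ≤ r a i → r a 0 ≤ r a j →
    (r a i < r a j ↔ r (!a) (j + 1) < r (!a) (i + 1))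

namespace IsFolded

variable {P : List ULap} {r r' : Bool → ℕ → ℝ}

theorem eq_zero_of_dvd (h : IsFolded P r) (a : Bool) {i : ℕ} (hi : P.length + 1 ∣ i) :
    r a i = r a 0 := by
  rcases i with _ | i
  · rfl
  · exact uaddress_eq_c_iff.1 ((h.addr a i).trans (useq_eq_c_of_dvd P hi))

theorem ne_zero (h : IsFolded P r) (a : Bool) {i : ℕ} (h0 : 0 < i) (hi : i ≤ P.length) :
    r a i ≠ r a 0 := by
  rcases i with _ | i
  · omega
  · intro e
    exact useq_ne_c P (Nat.lt_of_succ_le hi) ((h.addr a i).symm.trans (uaddress_eq_c_iff.2 e))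

theorem side (h : IsFolded P r) (h' : IsFolded P r') (a b : Bool) (i : ℕ) :
    (r a i < r a 0 ∧ r' b i < r' b 0) ∨ (r a i = r a 0 ∧ r' b i = r' b 0) ∨
      (r a 0 < r a i ∧ r' b 0 < r' b i) := by
  have e : uaddress (r a 0) (r a i) = uaddress (r' b 0) (r' b i) := by
    rcases i with _ | i
    · simp [uaddress_self]
    · rw [h.addr, h'.addr]
  rcases lt_trichotomy (r a i) (r a 0) with H | H | H
  · exact Or.inl ⟨H, uaddress_eq_l_iff.1 (e ▸ uaddress_eq_l_iff.2 H)⟩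
  · exact Or.inr (Or.inl ⟨H, uaddress_eq_c_iff.1 (e ▸ uaddress_eq_c_iff.2 H)⟩)
  · exact Or.inr (Or.inr ⟨H, uaddress_eq_r_iff.1 (e ▸ uaddress_eq_r_iff.2 H)⟩)

/-- `N` bounds the recursion: after `N` steps the index `i` is a multiple of the period and its
point is the turning point, where symbols decide. Both inequalities are carried together because the
right lap interchanges them. -/
theorem lt_iff_and (h : IsFolded P r) (h' : IsFolded P r') (N : ℕ) :
    ∀ (a b : Bool) (i j : ℕ), P.length + 1 ∣ i + N →
      (r a i < r a j ↔ r' b i < r' b j) ∧ (r a j < r a i ↔ r' b j < r' b i) := by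
  induction N with
  | zero =>
    intro a b i j hi
    rw [add_zero] at hi
    rw [h.eq_zero_of_dvd a hi, h'.eq_zero_of_dvd b hi]
    rcases h.side h' a b j with ⟨h1, h2⟩ | ⟨h1, h2⟩ | ⟨h1, h2⟩
    · simp [h1, h2, h1.not_gt, h2.not_gt]
    · simp [h1, h2]
    · simp [h1, h2, h1.not_gt, h2.not_gt]
  | succ N ih =>
    intro a b i j hi
    have ih' := ih (!a) (!b) (i + 1) (j + 1) (by convert hi using 1; ring)
    rcases h.side h' a b i with ⟨h1, h2⟩ | ⟨h1, h2⟩ | ⟨h1, h2⟩ <;>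
    rcases h.side h' a b j with ⟨h3, h4⟩ | ⟨h3, h4⟩ | ⟨h3, h4⟩
    case inl.inl =>
      rw [h.left a i j h1.le h3.le, h.left a j i h3.le h1.le, h'.left b i j h2.le h4.le,
        h'.left b j i h4.le h2.le]
      exact ih'
    case inr.inr.inr.inr =>
      rw [h.right a i j h1.le h3.le, h.right a j i h3.le h1.le, h'.right b i j h2.le h4.le,
        h'.right b j i h4.le h2.le]
      exact ih'.symm
    -- In the remaining cases the two points are not strictly on the same side, and their symbols
    -- alone decide the comparison.
    all_goals
      constructor <;> constructor <;> intro <;> linarith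

theorem lt_iff (h : IsFolded P r) (h' : IsFolded P r') (a b : Bool) (i j : ℕ) :
    r a i < r a j ↔ r' b i < r' b j :=
  (h.lt_iff_and h' (P.length * i) a b i j ⟨i, by ring⟩).1

theorem eq_iff (h : IsFolded P r) (h' : IsFolded P r') (a b : Bool) (i j : ℕ) :
    r a i = r a j ↔ r' b i = r' b j := by
  have h1 := h.lt_iff h' a b i j
  have h2 := h.lt_iff h' a b j i
  constructor <;> intro e
  · exact le_antisymm (not_lt.1 (h2.not.1 e.le.not_gt)) (not_lt.1 (h1.not.1 e.ge.not_gt))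
  · exact le_antisymm (not_lt.1 (h2.not.2 e.le.not_gt)) (not_lt.1 (h1.not.2 e.ge.not_gt))

/-- `IsFolded` does not assume that a map generates the sequences. The folding conditions give equal
successors in the other sequence, and `eq_iff` brings the equality back to this one. -/
theorem succ_eq (h : IsFolded P r) (a : Bool) {i j : ℕ} (e : r a i = r a j) :
    r a (i + 1) = r a (j + 1) := by
  rw [h.eq_iff h a (!a)]
  have key : ∀ i j, r a i = r a j → ¬ r (!a) (i + 1) < r (!a) (j + 1) := by
    intro i j e
    rcases le_total (r a i) (r a 0) with H | H
    · rw [← h.left a i j H (e ▸ H), e]; exact lt_irrefl _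
    · rw [← h.right a j i (e ▸ H) H, e]; exact lt_irrefl _
  exact le_antisymm (not_lt.1 (key j i e.symm)) (not_lt.1 (key i j e))

theorem add_eq (h : IsFolded P r) (a : Bool) {i j : ℕ} (e : r a i = r a j) (k : ℕ) :
    r a (i + k) = r a (j + k) := by
  induction k with
  | zero => exact e
  | succ k ih => exact h.succ_eq a ih

theorem mod_eq (h : IsFolded P r) (a : Bool) (k : ℕ) : r a (k % (P.length + 1)) = r a k := by
  have := h.add_eq a (h.eq_zero_of_dvd a (dvd_mul_right (P.length + 1) (k / (P.length + 1))))
    (k % (P.length + 1))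
  rw [Nat.div_add_mod, zero_add] at this
  exact this.symm

theorem injective (h : IsFolded P r) (a : Bool) :
    Function.Injective fun k : Fin (P.length + 1) => r a k := by
  have key : ∀ i j : ℕ, i < j → j ≤ P.length → r a i ≠ r a j := by
    intro i j hij hj e
    have h1 := h.add_eq a e (P.length + 1 - j)
    -- Shifting by the period minus `j` turns a coincidence into a return to the turning point at
    -- the index `i + p - j`, strictly between `0` and `p = P.length + 1`.
    rw [show j + (P.length + 1 - j) = P.length + 1 by omega,
      h.eq_zero_of_dvd a (dvd_refl (P.length + 1))] at h1
    exact h.ne_zero a (by omega) (by omega) h1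
  intro i j e
  rcases lt_trichotomy i j with H | H | H
  · exact (key i j H (by omega) e).elim
  · exact H
  · exact (key j i H (by omega) e.symm).elim

/-- The order and the dynamics of a folded family depend only on the kneading sequence. -/
theorem exists_enumeration (h : IsFolded P r) {n : ℕ} (hn : n = P.length) :
    ∃ (κ : Fin (n + 1) → ℕ) (τ : Fin (n + 1) → Fin (n + 1)),
      ∀ r', IsFolded P r' → ∀ a, StrictMono (fun i => r' a (κ i)) ∧
        (∀ k, ∃ i, ∀ b, r' b k = r' b (κ i)) ∧ ∀ i, r' a (κ i + 1) = r' a (κ (τ i)) := by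
  classical
  subst hn
  set s : Finset ℝ := Finset.univ.image fun k : Fin (P.length + 1) => r true k with hs
  have hc : s.card = P.length + 1 := by
    rw [hs, Finset.card_image_of_injective _ (h.injective true), Finset.card_univ,
      Fintype.card_fin]
  have hmem : ∀ k, r true k ∈ s := fun k => by
    rw [← h.mod_eq true k, hs]
    exact Finset.mem_image.2 ⟨⟨_, Nat.mod_lt _ (by omega)⟩, Finset.mem_univ _, rfl⟩
  have hκ : ∀ i, ∃ k, r true k = s.orderEmbOfFin hc i := fun i => by
    obtain ⟨k, -, hk⟩ := Finset.mem_image.1 (s.orderEmbOfFin_mem hc i)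
    exact ⟨k, hk⟩
  choose κ hκ using hκ
  have hsurj : ∀ k, ∃ i, r true k = r true (κ i) := fun k => by
    have : r true k ∈ Set.range (s.orderEmbOfFin hc) := by
      rw [Finset.range_orderEmbOfFin]; exact hmem k
    obtain ⟨i, hi⟩ := this
    exact ⟨i, by rw [hκ, hi]⟩
  -- `κ i` is a time at which the `i`-th smallest point is visited, and `τ i` is the rank of its
  -- successor. Both are read off one family and transfer to all others through `lt_iff` and
  -- `eq_iff`.
  choose τ hτ using fun i => hsurj (κ i + 1)
  refine ⟨κ, τ, fun r' h' a => ⟨fun i j hij => ?_, fun k => ?_, fun i => ?_⟩⟩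
  · rw [← h.lt_iff h' true a, hκ, hκ]
    exact (s.orderEmbOfFin hc).strictMono hij
  · obtain ⟨i, hi⟩ := hsurj k
    exact ⟨i, fun b => (h.eq_iff h' true b _ _).1 hi⟩
  · exact (h.eq_iff h' true a _ _).1 (hτ i)

end IsFolded

theorem IsUnimodal.iterate_mem {g : ℝ → ℝ} {b₀ c b₁ : ℝ} (h : IsUnimodal g b₀ c b₁) (k : ℕ) :
    g^[k] c ∈ Set.Icc b₀ b₁ :=
  h.mapsTo.iterate k ⟨h.lt_left.le, h.lt_right.le⟩

/-- A single unimodal orbit serves as both sequences, which makes it comparable with the two halves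
of a bimodal orbit. -/
theorem URealizedBy.isFolded {P : List ULap} {g : ℝ → ℝ} {b₀ c b₁ : ℝ}
    (h : URealizedBy P g b₀ c b₁) : IsFolded P fun _ k => g^[k] c where
  addr _ k := h.2 k
  left _ i j hi hj := by
    simp only [Function.iterate_succ_apply', Function.iterate_zero, id] at *
    exact (h.1.incr_left.lt_iff_lt ⟨(h.1.iterate_mem i).1, hi⟩ ⟨(h.1.iterate_mem j).1, hj⟩).symm
  right _ i j hi hj := by
    simp only [Function.iterate_succ_apply', Function.iterate_zero, id] at *
    exact (h.1.decr_right.lt_iff_gt ⟨hj, (h.1.iterate_mem j).2⟩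
      ⟨hi, (h.1.iterate_mem i).2⟩).symm

/-! ### Transition matrices of maps of finite ordered sets -/

/-- The transition matrix determined by the images of the division points: the interval between
consecutive points is mapped onto the interval between their images. -/
def coverMatrix {m : ℕ} (σ : Fin (m + 1) → Fin (m + 1)) : Matrix (Fin m) (Fin m) ℤ :=
  Matrix.of fun i j =>
    if min (σ i.castSucc : ℕ) (σ i.succ) ≤ j ∧ (j : ℕ) + 1 ≤ max (σ i.castSucc : ℕ) (σ i.succ)
    then 1 else 0

/-- On each interval the map is continuous and monotone, so the image is the interval between the
images of the endpoints, and inclusion becomes a comparison of indices. -/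
theorem transitionMatrix_eq_coverMatrix {m : ℕ} {f : ℝ → ℝ} {z : Fin (m + 1) → ℝ}
    {σ : Fin (m + 1) → Fin (m + 1)} (hz : StrictMono z) (hσ : ∀ i, f (z i) = z (σ i))
    (hc : ∀ i : Fin m, ContinuousOn f (Set.Icc (z i.castSucc) (z i.succ)))
    (hm : ∀ i : Fin m, MonotoneOn f (Set.Icc (z i.castSucc) (z i.succ)) ∨
      AntitoneOn f (Set.Icc (z i.castSucc) (z i.succ))) :
    transitionMatrix f z = coverMatrix σ := by
  ext i j
  have hle : ∀ k : Fin m, z k.castSucc ≤ z k.succ := fun k => (hz k.castSucc_lt_succ).le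
  have himg : f '' Set.Icc (z i.castSucc) (z i.succ) =
      Set.Icc (z (min (σ i.castSucc) (σ i.succ))) (z (max (σ i.castSucc) (σ i.succ))) := by
    rw [hz.monotone.map_min, hz.monotone.map_max, ← hσ, ← hσ]
    have h1 : z i.castSucc ∈ Set.Icc (z i.castSucc) (z i.succ) := Set.left_mem_Icc.2 (hle i)
    have h2 : z i.succ ∈ Set.Icc (z i.castSucc) (z i.succ) := Set.right_mem_Icc.2 (hle i)
    rcases hm i with H | H
    · rw [(hc i).image_Icc_of_monotoneOn (hle i) H, min_eq_left (H h1 h2 (hle i)),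
        max_eq_right (H h1 h2 (hle i))]
    · rw [(hc i).image_Icc_of_antitoneOn (hle i) H, min_eq_right (H h1 h2 (hle i)),
        max_eq_left (H h1 h2 (hle i))]
  simp only [transitionMatrix, coverMatrix, Matrix.of_apply]
  classical
  refine if_congr ?_ rfl rfl
  rw [himg, Set.Icc_subset_Icc_iff (hle j), hz.le_iff_le, hz.le_iff_le, Fin.le_def, Fin.le_def]
  simp only [Fin.coe_min, Fin.coe_max, Fin.val_castSucc, Fin.val_succ]

/-- A division point does not lie inside an interval between consecutive division points. -/
theorem le_castSucc_or_succ_le {m : ℕ} {z : Fin (m + 1) → ℝ} (hz : StrictMono z)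
    (k : Fin (m + 1)) (i : Fin m) : z k ≤ z i.castSucc ∨ z i.succ ≤ z k := by
  rw [hz.le_iff_le, hz.le_iff_le, Fin.le_def, Fin.le_def, Fin.val_castSucc, Fin.val_succ]
  omega

/-- The map of `2 (n + 1)` points that sends the `i`-th point on either side of the middle to the
`τ i`-th point on the opposite side, counting outwards. -/
def swapMap {n : ℕ} (τ : Fin (n + 1) → Fin (n + 1)) (k : Fin (2 * n + 1 + 1)) :
    Fin (2 * n + 1 + 1) :=
  if (k : ℕ) ≤ n then ⟨n + 1 + τ ⟨n - k, by omega⟩, by omega⟩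
  else ⟨n - τ ⟨k - (n + 1), by omega⟩, by omega⟩

theorem swapMap_left {n : ℕ} (τ : Fin (n + 1) → Fin (n + 1)) {k : Fin (2 * n + 1 + 1)}
    (i : Fin (n + 1)) (h : (k : ℕ) + i = n) : (swapMap τ k : ℕ) = n + 1 + τ i := by
  have : (⟨n - k, by omega⟩ : Fin (n + 1)) = i := Fin.ext (by simp; omega)
  simp [swapMap, show (k : ℕ) ≤ n by omega, this]

theorem swapMap_right {n : ℕ} (τ : Fin (n + 1) → Fin (n + 1)) {k : Fin (2 * n + 1 + 1)}
    (i : Fin (n + 1)) (h : (k : ℕ) = n + 1 + i) : (swapMap τ k : ℕ) = n - τ i := by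
  have : (⟨k - (n + 1), by omega⟩ : Fin (n + 1)) = i := Fin.ext (by simp; omega)
  simp [swapMap, show ¬ (k : ℕ) ≤ n by omega, this]

/-- The transitions from the middle interval to either side. -/
def middleRow {n : ℕ} (τ : Fin (n + 1) → Fin (n + 1)) : Matrix Unit (Fin n) ℤ :=
  Matrix.of fun _ j => if (j : ℕ) < τ 0 then 1 else 0

theorem middleRow_ne_zero {n : ℕ} {τ : Fin (n + 1) → Fin (n + 1)} (hn : 1 ≤ n) (h : τ 0 ≠ 0) :
    middleRow τ ≠ 0 := by
  intro e
  have h1 : (0 : ℕ) < τ 0 := Nat.pos_of_ne_zero fun h' => h (Fin.ext h')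
  have h2 := congrFun (congrFun e ()) ⟨0, hn⟩
  simp only [middleRow, Matrix.of_apply, h1, if_true, Matrix.zero_apply, one_ne_zero] at h2

theorem coverMatrix_swapMap {n : ℕ} (τ : Fin (n + 1) → Fin (n + 1)) :
    (coverMatrix (swapMap τ)).submatrix (blockEquiv n) (blockEquiv n) =
      Matrix.fromBlocks 1 (Matrix.fromCols (middleRow τ) (middleRow τ)) 0
        (Matrix.fromBlocks 0 (coverMatrix τ) (coverMatrix τ) 0) := by
  have hmid : ∀ j, coverMatrix (swapMap τ) ⟨n, by omega⟩ j =
      if n - (τ 0 : ℕ) ≤ j ∧ (j : ℕ) + 1 ≤ n + 1 + τ 0 then 1 else 0 := by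
    intro j
    simp only [coverMatrix, Matrix.of_apply]
    rw [swapMap_left τ (0 : Fin (n + 1)) (by simp), swapMap_right τ (0 : Fin (n + 1)) (by simp)]
    refine if_congr ?_ rfl rfl
    omega
  have hleft : ∀ (i : Fin n) (j), coverMatrix (swapMap τ) ⟨n - 1 - i, by omega⟩ j =
      if n + 1 + min (τ i.castSucc : ℕ) (τ i.succ) ≤ j ∧
        (j : ℕ) + 1 ≤ n + 1 + max (τ i.castSucc : ℕ) (τ i.succ) then 1 else 0 := by
    intro i j
    simp only [coverMatrix, Matrix.of_apply]
    -- Counting outwards reverses the order on the left: the left endpoint of the `i`-th interval is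
    -- the point numbered `i + 1` from the middle.
    rw [swapMap_left τ i.succ (by simp; omega), swapMap_left τ i.castSucc (by simp; omega)]
    refine if_congr ?_ rfl rfl
    omega
  have hright : ∀ (i : Fin n) (j), coverMatrix (swapMap τ) ⟨n + 1 + i, by omega⟩ j =
      if n - max (τ i.castSucc : ℕ) (τ i.succ) ≤ j ∧
        (j : ℕ) + 1 ≤ n - min (τ i.castSucc : ℕ) (τ i.succ) then 1 else 0 := by
    intro i j
    simp only [coverMatrix, Matrix.of_apply]
    rw [swapMap_right τ i.castSucc (by simp), swapMap_right τ i.succ (by simp; omega)]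
    refine if_congr ?_ rfl rfl
    omega
  ext (u | i | i) (v | j | j) <;>
    simp only [Matrix.submatrix_apply, blockEquiv, Equiv.ofBijective_apply, blockIndex, hmid,
      hleft, hright, Matrix.fromBlocks_apply₁₁, Matrix.fromBlocks_apply₁₂,
      Matrix.fromBlocks_apply₂₁, Matrix.fromBlocks_apply₂₂, Matrix.fromCols_apply_inl,
      Matrix.fromCols_apply_inr, Matrix.zero_apply, middleRow, Matrix.of_apply]
  · simp
  all_goals first
    | (refine if_congr ?_ rfl rfl; omega)
    | (refine if_neg ?_; omega)

/-! ### Interpolation -/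

/-- Strictly increasing finite data are interpolated by a strictly increasing continuous
function. -/
theorem exists_strictMono_interpolation {n : ℕ} {u v : Fin (n + 1) → ℝ} (hu : StrictMono u)
    (hv : StrictMono v) : ∃ H : ℝ → ℝ, Continuous H ∧ StrictMono H ∧ ∀ i, H (u i) = v i := by
  induction n with
  | zero =>
    refine ⟨fun x => x + (v 0 - u 0), by fun_prop, fun x y h => by simpa using h, fun i => ?_⟩
    rw [show i = 0 from Fin.ext (by omega)]; ring
  | succ n ih =>
    obtain ⟨H, hc, hm, hH⟩ := ih (hu.comp (Fin.strictMono_succ)) (hv.comp Fin.strictMono_succ)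
    have hu0 : u 0 < u 1 := hu (by simp)
    have hv0 : v 0 < v 1 := hv (by simp)
    set s : ℝ := (v 1 - v 0) / (u 1 - u 0) with hs
    have hspos : 0 < s := div_pos (by linarith) (by linarith)
    -- To the right of `u 1` this is the interpolation of the remaining points; to the left it is
    -- the line of slope `s` through the first two.
    refine ⟨fun x => H (max x (u 1)) + s * min (x - u 1) 0, by fun_prop, fun x y hxy => ?_, ?_⟩
    · rcases le_or_gt (u 1) x with h | h
      · have h' : u 1 ≤ y := h.trans hxy.le
        simp only [max_eq_left h, max_eq_left h', min_eq_right (sub_nonneg.2 h),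
          min_eq_right (sub_nonneg.2 h')]
        simpa using hm hxy
      · have h1 : H (max x (u 1)) ≤ H (max y (u 1)) :=
          hm.monotone (max_le_max hxy.le le_rfl)
        have h2 : min (x - u 1) 0 < min (y - u 1) 0 := by
          rw [min_eq_left (by linarith)]
          exact lt_min (by linarith) (by linarith)
        have := mul_lt_mul_of_pos_left h2 hspos
        simp only
        linarith
    · intro i
      refine Fin.cases ?_ (fun i => ?_) i
      · have h1 := hH 0
        simp only [Function.comp, Fin.succ_zero_eq_one] at h1
        simp only [max_eq_right hu0.le]
        rw [min_eq_left (by linarith), h1, hs]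
        have : u 1 - u 0 ≠ 0 := by linarith
        field_simp
        ring
      · have h1 : u 1 ≤ u i.succ := hu.monotone (by simp [Fin.le_def])
        simp only [max_eq_left h1, min_eq_right (sub_nonneg.2 h1)]
        simpa using hH i

/-! ### Comparison of symbol sequences with `M^∞` and `R M^∞` -/

theorem theta_zero (s : ℕ → Sym) : theta s 0 = (s 0).val := by simp [theta]

theorem theta_of_forall_M {s : ℕ → Sym} {j : ℕ} (h : ∀ i < j, s i = .M) :
    theta s j = (-1) ^ j * (s j).val := by
  have : ∏ i ∈ Finset.range j, (s i).eps = ∏ i ∈ Finset.range j, (-1 : ℤ) :=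
    Finset.prod_congr rfl fun i hi => by rw [h i (Finset.mem_range.1 hi)]; rfl
  rw [theta, this, Finset.prod_const, Finset.card_range]

theorem theta_seqM (j : ℕ) : theta seqM j = (-1) ^ j * 3 :=
  theta_of_forall_M fun _ _ => rfl

theorem eq_M_of_theta_eq {s : ℕ → Sym} {j : ℕ} (h : ∀ i < j, theta s i = theta seqM i) :
    ∀ i < j, s i = .M := by
  intro i
  induction i using Nat.strong_induction_on with
  | _ i ih =>
    intro hi
    have h1 := h i hi
    rw [theta_of_forall_M fun k hk => ih k hk (hk.trans hi), theta_seqM] at h1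
    have h2 : (s i).val = 3 := mul_left_cancel₀ (pow_ne_zero i (by norm_num)) h1
    cases hs : s i <;> simp_all [Sym.val]

/-- Agreement of the coordinates with those of `M^∞` forces a prefix of symbols `M`, each
contributing a factor `-1`. The number `3` is the value of `M`. -/
theorem exists_first_ne_M_of_seqM_lt {s : ℕ → Sym} (h : SeqLT seqM s) :
    ∃ j, (∀ i < j, s i = .M) ∧ (-1) ^ j * 3 < (-1) ^ j * (s j).val := by
  obtain ⟨j, hj, hlt⟩ := h
  have hM := eq_M_of_theta_eq fun i hi => (hj i hi).symm
  exact ⟨j, hM, by rwa [theta_seqM, theta_of_forall_M hM] at hlt⟩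

theorem exists_first_ne_M_of_lt_seqM {s : ℕ → Sym} (h : SeqLT s seqM) :
    ∃ j, (∀ i < j, s i = .M) ∧ (-1) ^ j * (s j).val < (-1) ^ j * 3 := by
  obtain ⟨j, hj, hlt⟩ := h
  have hM := eq_M_of_theta_eq hj
  exact ⟨j, hM, by rwa [theta_seqM, theta_of_forall_M hM] at hlt⟩

theorem three_le_val_of_seqM_lt {s : ℕ → Sym} (h : SeqLT seqM s) : 3 ≤ (s 0).val := by
  obtain ⟨j, hj, hlt⟩ := exists_first_ne_M_of_seqM_lt h
  rcases j with _ | j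
  · simp at hlt; exact hlt.le
  · rw [hj 0 (by omega)]; rfl

theorem theta_succ_of_R {s : ℕ → Sym} (h : s 0 = .R) (j : ℕ) :
    theta s (j + 1) = theta (fun i => s (i + 1)) j := by
  simp [theta, Finset.prod_range_succ', h, Sym.eps]

/-- An initial `R` has sign `+1`, so removing it from both sequences preserves the comparison. -/
theorem of_lt_seqRM {s : ℕ → Sym} (h : SeqLT s seqRM) :
    (s 0).val < 5 ∨ (s 0 = .R ∧ SeqLT (fun i => s (i + 1)) seqM) := by
  obtain ⟨j, hj, hlt⟩ := h
  rcases j with _ | j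
  · rw [theta_zero, theta_zero] at hlt
    exact Or.inl hlt
  · have h0 : s 0 = .R := by
      have := hj 0 (by omega)
      rw [theta_zero, theta_zero] at this
      cases hs : s 0 <;> simp_all [Sym.val, seqRM]
    have hRM : ∀ i, theta seqRM (i + 1) = theta seqM i := fun i => by
      rw [theta_succ_of_R (by simp [seqRM])]
      congr 1
    refine Or.inr ⟨h0, j, fun i hi => ?_, ?_⟩
    · rw [← theta_succ_of_R h0, hj (i + 1) (by omega), hRM]
    · rwa [← theta_succ_of_R h0, ← hRM]

/-! ### Addresses -/

section address
variable {c₁ c₂ x : ℝ}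

theorem address_cases (h : c₁ < c₂) :
    (x < c₁ ∧ address c₁ c₂ x = .L) ∨ (x = c₁ ∧ address c₁ c₂ x = .A) ∨
    ((c₁ < x ∧ x < c₂) ∧ address c₁ c₂ x = .M) ∨ (x = c₂ ∧ address c₁ c₂ x = .B) ∨
    (c₂ < x ∧ address c₁ c₂ x = .R) := by
  unfold address
  rcases lt_trichotomy x c₁ with h1 | h1 | h1
  · simp [h1]
  · simp [h1]
  · rcases lt_trichotomy x c₂ with h2 | h2 | h2
    · simp [h1, h2, h1.not_gt, h1.ne']
    · simp [h2, h.not_gt, h.ne']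
    · simp [h1.not_gt, h1.ne', h2, h2.not_gt, h2.ne']

theorem address_neg (h : c₁ < c₂) :
    address (-c₂) (-c₁) (-x) = (address c₁ c₂ x).conj := by
  rcases address_cases (x := x) h with ⟨h1, h2⟩ | ⟨h1, h2⟩ | ⟨h1, h2⟩ | ⟨h1, h2⟩ | ⟨h1, h2⟩ <;>
  rcases address_cases (x := -x) (neg_lt_neg h) with
    ⟨h3, h4⟩ | ⟨h3, h4⟩ | ⟨h3, h4⟩ | ⟨h3, h4⟩ | ⟨h3, h4⟩ <;>
  first
  | (rw [h2, h4]; rfl)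
  | (exfalso; linarith)

/-- The unimodal symbol that corresponds to a bimodal symbol. -/
def Sym.fold : Sym → USym
  | .L => .r
  | .A => .c
  | .M => .l
  | .B => .c
  | .R => .r

theorem Sym.fold_conj (X : Sym) : X.conj.fold = X.fold := by cases X <;> rfl

theorem Sym.conj_conj (X : Sym) : X.conj.conj = X := by cases X <;> rfl

theorem uaddress_right (h : c₁ < c₂) (hx : c₁ < x) :
    uaddress c₂ x = (address c₁ c₂ x).fold := by
  rcases address_cases (x := x) h with ⟨h1, h2⟩ | ⟨h1, h2⟩ | ⟨h1, h2⟩ | ⟨h1, h2⟩ | ⟨h1, h2⟩ <;>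
    rw [h2]
  · linarith
  · linarith
  · exact uaddress_eq_l_iff.2 h1.2
  · exact uaddress_eq_c_iff.2 h1
  · exact uaddress_eq_r_iff.2 h1

theorem uaddress_left (h : c₁ < c₂) (hx : x < c₂) :
    uaddress (-c₁) (-x) = (address c₁ c₂ x).fold := by
  rw [uaddress_right (neg_lt_neg h) (neg_lt_neg hx), address_neg h, Sym.fold_conj]

theorem le_of_three_lt_val (h : c₁ < c₂) (hx : 3 < (address c₁ c₂ x).val) : c₂ ≤ x := by
  rcases address_cases (x := x) h with ⟨h1, h2⟩ | ⟨h1, h2⟩ | ⟨h1, h2⟩ | ⟨h1, h2⟩ | ⟨h1, h2⟩ <;>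
    simp [h2, Sym.val] at hx
  · exact h1.ge
  · exact h1.le

theorem le_of_val_lt_three (h : c₁ < c₂) (hx : (address c₁ c₂ x).val < 3) : x ≤ c₁ := by
  rcases address_cases (x := x) h with ⟨h1, h2⟩ | ⟨h1, h2⟩ | ⟨h1, h2⟩ | ⟨h1, h2⟩ | ⟨h1, h2⟩ <;>
    simp [h2, Sym.val] at hx
  · exact h1.le
  · exact h1.le

theorem lt_of_three_le_val (h : c₁ < c₂) (hx : 3 ≤ (address c₁ c₂ x).val) : c₁ < x := by
  rcases address_cases (x := x) h with ⟨h1, h2⟩ | ⟨h1, h2⟩ | ⟨h1, h2⟩ | ⟨h1, h2⟩ | ⟨h1, h2⟩ <;>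
    simp [h2, Sym.val] at hx
  · exact h1.1
  · linarith
  · linarith

theorem le_of_val_lt_five (h : c₁ < c₂) (hx : (address c₁ c₂ x).val < 5) : x ≤ c₂ := by
  rcases address_cases (x := x) h with ⟨h1, h2⟩ | ⟨h1, h2⟩ | ⟨h1, h2⟩ | ⟨h1, h2⟩ | ⟨h1, h2⟩ <;>
    simp [h2, Sym.val] at hx
  · linarith
  · linarith
  · exact h1.2.le
  · exact h1.le

theorem mem_Ioo_of_address_eq_M (h : c₁ < c₂) (hx : address c₁ c₂ x = .M) :
    x ∈ Set.Ioo c₁ c₂ := by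
  rcases address_cases (x := x) h with ⟨h1, h2⟩ | ⟨h1, h2⟩ | ⟨h1, h2⟩ | ⟨h1, h2⟩ | ⟨h1, h2⟩ <;>
    simp [h2] at hx
  exact h1

end address

/-! ### The reflected map -/

section bimodal
variable {S : Data} {f : ℝ → ℝ} {c₀ c₁ c₂ c₃ q : ℝ}

theorem IsBimodal.neg (h : IsBimodal f c₀ c₁ c₂ c₃) :
    IsBimodal (fun x => -f (-x)) (-c₃) (-c₂) (-c₁) (-c₀) where
  lt₀₁ := neg_lt_neg h.lt₂₃
  lt₁₂ := neg_lt_neg h.lt₁₂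
  lt₂₃ := neg_lt_neg h.lt₀₁
  mapsTo x hx := by
    have := h.mapsTo (x := -x) ⟨by linarith [hx.2], by linarith [hx.1]⟩
    exact ⟨neg_le_neg this.2, neg_le_neg this.1⟩
  continuousOn := (h.continuousOn.comp continuousOn_neg fun x hx =>
    ⟨by linarith [hx.2], by linarith [hx.1]⟩).neg
  incr_left x hx y hy hxy := neg_lt_neg <| h.incr_right (a := -y) (b := -x)
    ⟨by linarith [hy.2], by linarith [hy.1]⟩ ⟨by linarith [hx.2], by linarith [hx.1]⟩
    (neg_lt_neg hxy)
  decr_middle x hx y hy hxy := neg_lt_neg <| h.decr_middle (a := -y) (b := -x)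
    ⟨by linarith [hy.2], by linarith [hy.1]⟩ ⟨by linarith [hx.2], by linarith [hx.1]⟩
    (neg_lt_neg hxy)
  incr_right x hx y hy hxy := neg_lt_neg <| h.incr_left (a := -y) (b := -x)
    ⟨by linarith [hy.2], by linarith [hy.1]⟩ ⟨by linarith [hx.2], by linarith [hx.1]⟩
    (neg_lt_neg hxy)

theorem iterate_neg (f : ℝ → ℝ) (k : ℕ) (x : ℝ) : (fun x => -f (-x))^[k] (-x) = -f^[k] x := by
  induction k with
  | zero => rfl
  | succ k ih => rw [Function.iterate_succ_apply', ih, Function.iterate_succ_apply', neg_neg]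

/-- Reflection interchanges the turning points and conjugates symbols, so symmetric data are
preserved even when `f` is not odd. Every statement about one half thereby yields the statement
about the other. -/
theorem Data.RealizedBy.neg (h : S.RealizedBy f c₀ c₁ c₂ c₃) :
    S.RealizedBy (fun x => -f (-x)) (-c₃) (-c₂) (-c₁) (-c₀) := by
  refine ⟨h.1.neg, fun j => ?_⟩
  rw [iterate_neg, iterate_neg, address_neg h.1.lt₁₂, address_neg h.1.lt₁₂, (h.2 j).1, (h.2 j).2,
    Sym.conj_conj]
  exact ⟨rfl, rfl⟩

/-! ### The middle fixed point separates the orbits -/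

/-- Each step in the decreasing middle lap moves the point to the other side of `q`. The resulting
sign `(-1)^j` is the one in the invariant coordinate, so comparison with `M^∞` becomes position
relative to `q`. -/
theorem IsBimodal.side_iff (h : IsBimodal f c₀ c₁ c₂ c₃) (hq : q ∈ Set.Ioo c₁ c₂)
    (hfq : f q = q) (j : ℕ) : ∀ x, (∀ i < j, f^[i] x ∈ Set.Ioo c₁ c₂) →
      (q < x ↔ 0 < (-1) ^ j * (f^[j] x - q)) ∧ (x < q ↔ (-1) ^ j * (f^[j] x - q) < 0) := by
  induction j with
  | zero => intro x _; simp
  | succ j ih =>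
    intro x hx
    have hx0 : x ∈ Set.Ioo c₁ c₂ := hx 0 (by omega)
    have hqm := Set.Ioo_subset_Icc_self hq
    have hxm := Set.Ioo_subset_Icc_self hx0
    have h1 := h.decr_middle.lt_iff_gt hqm hxm
    have h2 := h.decr_middle.lt_iff_gt hxm hqm
    rw [hfq] at h1 h2
    obtain ⟨h3, h4⟩ := ih (f x) fun i hi => by
      rw [← Function.iterate_succ_apply]; exact hx (i + 1) (by omega)
    rw [Function.iterate_succ_apply, pow_succ]
    constructor
    · rw [← h2, h4]; constructor <;> intro <;> linarith
    · rw [← h1, h3]; constructor <;> intro <;> linarith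

theorem IsBimodal.lt_of_seqM_lt (h : IsBimodal f c₀ c₁ c₂ c₃) (hq : q ∈ Set.Ioo c₁ c₂)
    (hfq : f q = q) {x : ℝ} (hx : SeqLT seqM fun k => address c₁ c₂ (f^[k] x)) : q < x := by
  obtain ⟨j, hj, hlt⟩ := exists_first_ne_M_of_seqM_lt hx
  rw [(h.side_iff hq hfq j x fun i hi => mem_Ioo_of_address_eq_M h.lt₁₂ (hj i hi)).1]
  rcases Nat.even_or_odd j with e | e
  · rw [e.neg_one_pow] at *
    linarith [le_of_three_lt_val h.lt₁₂ (by linarith : 3 < (address c₁ c₂ (f^[j] x)).val), hq.2]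
  · rw [e.neg_one_pow] at *
    linarith [le_of_val_lt_three h.lt₁₂ (by linarith : (address c₁ c₂ (f^[j] x)).val < 3), hq.1]

theorem IsBimodal.lt_of_lt_seqM (h : IsBimodal f c₀ c₁ c₂ c₃) (hq : q ∈ Set.Ioo c₁ c₂)
    (hfq : f q = q) {x : ℝ} (hx : SeqLT (fun k => address c₁ c₂ (f^[k] x)) seqM) : x < q := by
  obtain ⟨j, hj, hlt⟩ := exists_first_ne_M_of_lt_seqM hx
  rw [(h.side_iff hq hfq j x fun i hi => mem_Ioo_of_address_eq_M h.lt₁₂ (hj i hi)).2]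
  rcases Nat.even_or_odd j with e | e
  · rw [e.neg_one_pow] at *
    linarith [le_of_val_lt_three h.lt₁₂ (by linarith : (address c₁ c₂ (f^[j] x)).val < 3), hq.1]
  · rw [e.neg_one_pow] at *
    linarith [le_of_three_lt_val h.lt₁₂ (by linarith : 3 < (address c₁ c₂ (f^[j] x)).val), hq.2]

theorem Data.RealizedBy.lt_apply (h : S.RealizedBy f c₀ c₁ c₂ c₃) (h1 : SeqLT seqM S.seq) :
    c₁ < f c₁ := by
  have := three_le_val_of_seqM_lt h1
  rw [← (h.2 0).1] at this
  exact lt_of_three_le_val h.1.lt₁₂ this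

theorem Data.RealizedBy.exists_fixed (h : S.RealizedBy f c₀ c₁ c₂ c₃) (h1 : SeqLT seqM S.seq) :
    ∃ q ∈ Set.Ioo c₁ c₂, f q = q := by
  have ha := h.lt_apply h1
  have hb := h.neg.lt_apply h1
  rw [neg_neg] at hb
  have hc : ContinuousOn (fun x => x - f x) (Set.Icc c₁ c₂) :=
    continuousOn_id.sub (h.1.continuousOn.mono
      (Set.Icc_subset_Icc h.1.lt₀₁.le h.1.lt₂₃.le))
  -- The bound `c₁ < f c₁` and its reflection `f c₂ < c₂` give `x - f x` opposite signs at the two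
  -- turning points.
  obtain ⟨q, hq, e⟩ := intermediate_value_Ioo h.1.lt₁₂.le hc
    (show (0 : ℝ) ∈ Set.Ioo (c₁ - f c₁) (c₂ - f c₂) from ⟨by linarith, by linarith⟩)
  exact ⟨q, hq, by simp only at e; linarith⟩

theorem Data.RealizedBy.lt_apply_and (h : S.RealizedBy f c₀ c₁ c₂ c₃) (h1 : SeqLT seqM S.seq)
    (h2 : SeqLT S.seq seqRM) (hq : q ∈ Set.Ioo c₁ c₂) (hfq : f q = q) :
    q < f c₁ ∧ f (f c₁) < q := by
  have hs : S.seq = fun k => address c₁ c₂ (f^[k] (f c₁)) := funext fun k => (h.2 k).1.symm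
  have ha : q < f c₁ := h.1.lt_of_seqM_lt hq hfq (by rwa [hs] at h1)
  refine ⟨ha, ?_⟩
  -- Either `f c₁` is still in the closed middle lap and one application of `f` crosses `q`, or `S`
  -- begins with `R` and its shift is below `M^∞`.
  rcases of_lt_seqRM h2 with h3 | ⟨-, h3⟩
  · rw [← (h.2 0).1] at h3
    have h4 : f c₁ ≤ c₂ := le_of_val_lt_five h.1.lt₁₂ h3
    have := h.1.decr_middle (Set.Ioo_subset_Icc_self hq) ⟨(hq.1.trans ha).le, h4⟩ ha
    rwa [hfq] at this
  · refine h.1.lt_of_lt_seqM hq hfq ?_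
    rwa [hs] at h3

/-! ### The folded orbits -/

/-- The points `f^k(c)` with `k` even and `f^k(c')` with `k` odd. -/
def altOrbit (f : ℝ → ℝ) (c c' : ℝ) (k : ℕ) : ℝ := f^[k] (if Even k then c else c')

theorem altOrbit_zero (f : ℝ → ℝ) (c c' : ℝ) : altOrbit f c c' 0 = c := by simp [altOrbit]

theorem altOrbit_succ (f : ℝ → ℝ) (c c' : ℝ) (k : ℕ) :
    altOrbit f c c' (k + 1) = f (altOrbit f c' c k) := by
  simp only [altOrbit, Function.iterate_succ_apply', Nat.even_add_one]
  by_cases hk : Even k <;> simp [hk]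

theorem range_altOrbit (f : ℝ → ℝ) (c c' : ℝ) :
    Set.range (altOrbit f c c') = evenOrbit f c ∪ oddOrbit f c' := by
  ext x
  simp only [Set.mem_range, Set.mem_union, evenOrbit, oddOrbit]
  constructor
  · rintro ⟨k, rfl⟩
    rcases Nat.even_or_odd' k with ⟨j, rfl | rfl⟩
    · exact Or.inl ⟨j, by simp [altOrbit]⟩
    · exact Or.inr ⟨j, by simp [altOrbit]⟩
  · rintro (⟨j, rfl⟩ | ⟨j, rfl⟩)
    · exact ⟨2 * j, by simp [altOrbit]⟩
    · exact ⟨2 * j + 1, by simp [altOrbit]⟩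

theorem orbit_eq (f : ℝ → ℝ) (c : ℝ) : orbit f c = evenOrbit f c ∪ oddOrbit f c := by
  rw [← range_altOrbit, orbit]
  congr 1
  funext k
  simp [altOrbit]

theorem orbit_union_orbit (f : ℝ → ℝ) (c c' : ℝ) :
    orbit f c ∪ orbit f c' = Set.range (altOrbit f c c') ∪ Set.range (altOrbit f c' c) := by
  rw [range_altOrbit, range_altOrbit, orbit_eq, orbit_eq]
  ext x; simp only [Set.mem_union]; tauto

/-- The right halves of the turning orbits, and the reflections of the left halves. -/
def foldedOrbit (f : ℝ → ℝ) (c₁ c₂ : ℝ) : Bool → ℕ → ℝ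
  | true, k => altOrbit f c₂ c₁ k
  | false, k => -altOrbit f c₁ c₂ k

/-- Folding forgets conjugation, so the block `P B P̄ A` of length `2p` becomes `PcPc` and has the
same folded sequence as `P A`. -/
theorem Data.fold_seq (S : Data) (k : ℕ) : (S.seq k).fold = useq S.unimodal k := by
  have hf : ∀ (l : List Sym) (i : ℕ), (l.getD i .A).fold = (l.map Sym.fold).getD i .c := by
    intro l i
    rw [show USym.c = Sym.fold .A from rfl, List.getD_map]
  have e1 : (Sym.fold ∘ Lap.toSym) = (ULap.toUSym ∘ Lap.toULap) := by
    funext X; cases X <;> rfl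
  have e2 : (Sym.fold ∘ fun X : Lap => X.toSym.conj) = (ULap.toUSym ∘ Lap.toULap) := by
    funext X; cases X <;> rfl
  rcases S with P | P
  · simp only [Data.seq, hf, useq, Data.unimodal, Data.block, Data.word, List.map_append,
      List.map_map, e1, List.length_append, List.length_map, List.length_singleton]
    rfl
  · simp only [Data.seq, hf, useq, Data.unimodal, Data.block, Data.word, List.map_append,
      List.map_map, e1, e2, List.length_append, List.length_map, List.length_singleton]
    set Q := P.map (ULap.toUSym ∘ Lap.toULap) with hQ
    have hl : Q.length = P.length := by simp [hQ]
    change (Q ++ [USym.c] ++ Q ++ [USym.c]).getD _ _ = (Q ++ [USym.c]).getD _ _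
    rw [List.append_assoc (Q ++ [USym.c]),
      show P.length + 1 + P.length + 1 = (P.length + 1) * 2 by ring]
    have hlt : k % ((P.length + 1) * 2) < (P.length + 1) * 2 := Nat.mod_lt _ (by omega)
    rw [← Nat.mod_mod_of_dvd k (dvd_mul_right (P.length + 1) 2)]
    set m := k % ((P.length + 1) * 2)
    rcases lt_or_ge m (P.length + 1) with hm | hm
    · rw [Nat.mod_eq_of_lt hm, List.getD_append _ _ _ _ (by simp [hl]; omega)]
    · rw [Nat.mod_eq_sub_mod hm, Nat.mod_eq_of_lt (by omega),
        List.getD_append_right _ _ _ _ (by simp [hl]; omega)]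
      simp [hl]

theorem Data.RealizedBy.fold_altOrbit (h : S.RealizedBy f c₀ c₁ c₂ c₃) (k : ℕ) :
    (address c₁ c₂ (altOrbit f c₂ c₁ (k + 1))).fold = useq S.unimodal k ∧
      (address c₁ c₂ (altOrbit f c₁ c₂ (k + 1))).fold = useq S.unimodal k := by
  rw [← S.fold_seq]
  unfold altOrbit
  split_ifs
  · rw [(h.2 k).1, (h.2 k).2, Sym.fold_conj]; exact ⟨rfl, rfl⟩
  · rw [(h.2 k).1, (h.2 k).2, Sym.fold_conj]; exact ⟨rfl, rfl⟩

/-- The half `[q, f(c₁)]` is mapped into `[f(c₂), q]`. -/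
theorem IsBimodal.apply_mem (h : IsBimodal f c₀ c₁ c₂ c₃) (hq : q ∈ Set.Ioo c₁ c₂) (hfq : f q = q)
    (h1 : f (f c₁) < q) {x : ℝ} (hx : x ∈ Set.Icc q (f c₁)) : f x ∈ Set.Icc (f c₂) q := by
  have hm : f c₁ ≤ c₃ := (h.mapsTo ⟨h.lt₀₁.le, (h.lt₁₂.trans h.lt₂₃).le⟩).2
  rcases le_total x c₂ with hx2 | hx2
  · have hxm : x ∈ Set.Icc c₁ c₂ := ⟨hq.1.le.trans hx.1, hx2⟩
    refine ⟨h.decr_middle.antitoneOn hxm (Set.right_mem_Icc.2 h.lt₁₂.le) hx2, ?_⟩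
    have := h.decr_middle.antitoneOn (Set.Ioo_subset_Icc_self hq) hxm hx.1
    rwa [hfq] at this
  · have hxm : x ∈ Set.Icc c₂ c₃ := ⟨hx2, hx.2.trans hm⟩
    exact ⟨h.incr_right.monotoneOn (Set.left_mem_Icc.2 h.lt₂₃.le) hxm hx2,
      (h.incr_right.monotoneOn hxm ⟨hx2.trans hx.2, hm⟩ hx.2).trans h1.le⟩

/-- This keeps the turning orbits strictly off `q`, so that the two halves are disjoint. -/
theorem IsBimodal.apply_ne (h : IsBimodal f c₀ c₁ c₂ c₃) (hq : q ∈ Set.Ioo c₁ c₂) (hfq : f q = q)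
    (h1 : f (f c₁) < q) {x : ℝ} (hx : x ∈ Set.Ioc q (f c₁)) : f x ≠ q := by
  have hm : f c₁ ≤ c₃ := (h.mapsTo ⟨h.lt₀₁.le, (h.lt₁₂.trans h.lt₂₃).le⟩).2
  rcases le_total x c₂ with hx2 | hx2
  · have := h.decr_middle (Set.Ioo_subset_Icc_self hq) ⟨(hq.1.trans hx.1).le, hx2⟩ hx.1
    rw [hfq] at this
    exact this.ne
  · exact ((h.incr_right.monotoneOn ⟨hx2, hx.2.trans hm⟩ ⟨hx2.trans hx.2, hm⟩ hx.2).trans_lt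
      h1).ne

/-- The dynamics of the turning orbits of a map that realizes data in `𝒟₁`: with respect to a
fixed point `q` in the middle lap, the two halves of the orbits are exchanged and folded. -/
theorem Data.RealizedBy.exists_isFolded (h : S.RealizedBy f c₀ c₁ c₂ c₃)
    (h1 : SeqLT seqM S.seq) (h2 : SeqLT S.seq seqRM) :
    ∃ q ∈ Set.Ioo c₁ c₂, f q = q ∧ f (f c₁) < q ∧
      (∀ k, altOrbit f c₂ c₁ k ∈ Set.Ioc q (f c₁)) ∧
      (∀ k, altOrbit f c₁ c₂ k ∈ Set.Ico (f c₂) q) ∧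
      IsFolded S.unimodal (foldedOrbit f c₁ c₂) := by
  obtain ⟨q, hq, hfq⟩ := h.exists_fixed h1
  have hq' : -q ∈ Set.Ioo (-c₂) (-c₁) := ⟨neg_lt_neg hq.2, neg_lt_neg hq.1⟩
  have hfq' : (fun x => -f (-x)) (-q) = -q := by simp [hfq]
  obtain ⟨ha, hb⟩ := h.lt_apply_and h1 h2 hq hfq
  obtain ⟨ha', hb'⟩ := h.neg.lt_apply_and h1 h2 hq' hfq'
  simp only [neg_neg] at ha' hb'
  have hmap : ∀ x ∈ Set.Ioc q (f c₁), f x ∈ Set.Ico (f c₂) q := fun x hx =>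
    have := h.1.apply_mem hq hfq hb ⟨hx.1.le, hx.2⟩
    ⟨this.1, this.2.lt_of_ne (h.1.apply_ne hq hfq hb hx)⟩
  have hmap' : ∀ x ∈ Set.Ico (f c₂) q, f x ∈ Set.Ioc q (f c₁) := by
    intro x hx
    have hx' : -x ∈ Set.Ioc (-q) ((fun x => -f (-x)) (-c₂)) := by
      simp only [neg_neg]; exact ⟨neg_lt_neg hx.2, neg_le_neg hx.1⟩
    have h3 := h.1.neg.apply_mem hq' hfq' (by simpa using hb') ⟨hx'.1.le, hx'.2⟩
    have h4 := h.1.neg.apply_ne hq' hfq' (by simpa using hb') hx'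
    simp only [neg_neg, Set.mem_Icc, neg_le_neg_iff, ne_eq, neg_inj] at h3 h4
    exact ⟨lt_of_le_of_ne h3.2 (Ne.symm h4), h3.1⟩
  -- The induction starts at index `1`, at the points `f c₁` and `f c₂`; that `c₂ ≤ f c₁` and `f c₂
  -- ≤ c₁` is not yet known.
  have hstep : ∀ k, altOrbit f c₂ c₁ (k + 1) ∈ Set.Ioc q (f c₁) ∧
      altOrbit f c₁ c₂ (k + 1) ∈ Set.Ico (f c₂) q := by
    intro k
    induction k with
    | zero =>
      rw [altOrbit_succ, altOrbit_succ, altOrbit_zero, altOrbit_zero]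
      exact ⟨⟨ha, le_rfl⟩, ⟨le_rfl, by linarith⟩⟩
    | succ k ih =>
      rw [altOrbit_succ f c₂ c₁ (k + 1), altOrbit_succ f c₁ c₂ (k + 1)]
      exact ⟨hmap' _ ih.2, hmap _ ih.1⟩
  have hR : ∀ k, q < altOrbit f c₂ c₁ k := by
    rintro (_ | k)
    · rw [altOrbit_zero]; exact hq.2
    · exact (hstep k).1.1
  have hL : ∀ k, altOrbit f c₁ c₂ k < q := by
    rintro (_ | k)
    · rw [altOrbit_zero]; exact hq.1
    · exact (hstep k).2.2
  have hR3 : ∀ k, altOrbit f c₂ c₁ k ≤ c₃ := by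
    rintro (_ | k)
    · rw [altOrbit_zero]; exact h.1.lt₂₃.le
    · exact (hstep k).1.2.trans (h.1.mapsTo ⟨h.1.lt₀₁.le, (h.1.lt₁₂.trans h.1.lt₂₃).le⟩).2
  have hL0 : ∀ k, c₀ ≤ altOrbit f c₁ c₂ k := by
    rintro (_ | k)
    · rw [altOrbit_zero]; exact h.1.lt₀₁.le
    · exact (h.1.mapsTo ⟨(h.1.lt₀₁.trans h.1.lt₁₂).le, h.1.lt₂₃.le⟩).1.trans (hstep k).2.1
  have hfold : IsFolded S.unimodal (foldedOrbit f c₁ c₂) := by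
    refine ⟨?_, ?_, ?_⟩
    · rintro (_ | _) k
      · simp only [foldedOrbit, altOrbit_zero]
        rw [uaddress_left h.1.lt₁₂ ((hL _).trans hq.2), (h.fold_altOrbit k).2]
      · simp only [foldedOrbit, altOrbit_zero]
        rw [uaddress_right h.1.lt₁₂ (hq.1.trans (hR _)), (h.fold_altOrbit k).1]
    -- The points concerned lie in the middle lap; reflecting one of the halves turns the decreasing
    -- `f` into an order-preserving step. In the outer laps, treated next, the increasing `f`
    -- becomes order-reversing.
    · rintro (_ | _) i j hi hj
      · simp only [foldedOrbit, altOrbit_zero, Bool.not_false, altOrbit_succ, neg_le_neg_iff,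
          neg_lt_neg_iff] at *
        exact (h.1.decr_middle.lt_iff_gt ⟨hi, ((hL i).trans hq.2).le⟩
          ⟨hj, ((hL j).trans hq.2).le⟩).symm
      · simp only [foldedOrbit, altOrbit_zero, Bool.not_true, altOrbit_succ, neg_lt_neg_iff] at *
        exact (h.1.decr_middle.lt_iff_gt ⟨(hq.1.trans (hR j)).le, hj⟩
          ⟨(hq.1.trans (hR i)).le, hi⟩).symm
    · rintro (_ | _) i j hi hj
      · simp only [foldedOrbit, altOrbit_zero, Bool.not_false, altOrbit_succ, neg_le_neg_iff,
          neg_lt_neg_iff] at *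
        exact (h.1.incr_left.lt_iff_lt ⟨hL0 j, hj⟩ ⟨hL0 i, hi⟩).symm
      · simp only [foldedOrbit, altOrbit_zero, Bool.not_true, altOrbit_succ, neg_lt_neg_iff] at *
        exact (h.1.incr_right.lt_iff_lt ⟨hi, hR3 i⟩ ⟨hj, hR3 j⟩).symm
  refine ⟨q, hq, hfq, hb, ?_, ?_, hfold⟩
  · rintro (_ | k)
    -- By periodicity the turning point reappears at index `p ≥ 1`, where the bounds are already
    -- known.
    · rw [← show altOrbit f c₂ c₁ _ = altOrbit f c₂ c₁ 0 from
        hfold.eq_zero_of_dvd true (dvd_refl _)]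
      exact (hstep _).1
    · exact (hstep k).1
  · rintro (_ | k)
    · rw [← show altOrbit f c₁ c₂ _ = altOrbit f c₁ c₂ 0 from
        neg_inj.1 (hfold.eq_zero_of_dvd false (dvd_refl _))]
      exact (hstep _).2
    · exact (hstep k).2

end bimodal

/-! ### The unimodal map obtained by folding -/

theorem nil_mem_setT : ([] : List ULap) ∈ setT := by
  refine ⟨fun x => -|x|, -1, 0, 1, ⟨by norm_num, by norm_num, fun x hx => ?_, by fun_prop,
    fun x hx y hy hxy => ?_, fun x hx y hy hxy => ?_⟩, fun j => ?_⟩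
  · exact ⟨neg_le_neg (abs_le.2 hx), (neg_nonpos.2 (abs_nonneg x)).trans zero_le_one⟩
  · simpa [abs_of_nonpos hx.2, abs_of_nonpos hy.2] using hxy
  · simpa [abs_of_nonneg hx.1, abs_of_nonneg hy.1] using hxy
  · have : (fun x : ℝ => -|x|)^[j + 1] 0 = 0 := Function.iterate_fixed (by simp) _
    rw [this, uaddress_self, useq_eq_c_of_dvd [] (by simp)]

theorem Data.RealizedBy.unimodal_mem_setT {S : Data} {f : ℝ → ℝ} {c₀ c₁ c₂ c₃ : ℝ}
    (h : S.RealizedBy f c₀ c₁ c₂ c₃) (h1 : SeqLT seqM S.seq) (h2 : SeqLT S.seq seqRM) :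
    S.unimodal ∈ setT := by
  -- For `p = 1` one has `f c₁ = c₂`, and the interval `[q, f c₁]` would leave no decreasing lap.
  by_cases hnil : S.unimodal = []
  · rw [hnil]; exact nil_mem_setT
  obtain ⟨q, hq, hfq, hb, hR, hL, hfold⟩ := h.exists_isFolded h1 h2
  obtain ⟨κ, τ, hκ⟩ := hfold.exists_enumeration rfl
  have hR0 := hR 0
  rw [altOrbit_zero] at hR0
  have hc : c₂ < f c₁ := by
    refine lt_of_le_of_ne hR0.2 fun e => ?_
    refine hfold.ne_zero true one_pos (List.length_pos_iff.2 hnil) ?_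
    simp only [foldedOrbit, altOrbit_zero]
    rw [← zero_add 1, altOrbit_succ, altOrbit_zero]
    exact e.symm
  have hu : StrictMono (Matrix.vecCons (-q) fun i => foldedOrbit f c₁ c₂ false (κ i)) :=
    (hκ _ hfold false).1.vecCons (neg_lt_neg (hL _).2)
  have hv : StrictMono (Matrix.vecCons q fun i => foldedOrbit f c₁ c₂ true (κ i)) :=
    (hκ _ hfold true).1.vecCons (hR _).1
  -- `H` identifies the reflected left half with the right half; the extra pair `-q ↦ q` makes `[q,
  -- f c₁]` invariant under `x ↦ H (-f x)`.
  obtain ⟨H, hHc, hHm, hH⟩ := exists_strictMono_interpolation hu hv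
  have hHq : H (-q) = q := by simpa using hH 0
  have hHk : ∀ k, H (-altOrbit f c₁ c₂ k) = altOrbit f c₂ c₁ k := by
    intro k
    obtain ⟨i, hi⟩ := (hκ _ hfold true).2.1 k
    have e1 := hi false
    have e2 := hi true
    have e3 := hH i.succ
    simp only [Matrix.cons_val_succ] at e3
    rw [← e1, ← e2] at e3
    exact e3
  have hHmax : H (-f c₂) = f c₁ := by
    have := hHk (0 + 1)
    rwa [altOrbit_succ, altOrbit_succ, altOrbit_zero, altOrbit_zero] at this
  have hf3 : f c₁ ≤ c₃ := (h.1.mapsTo ⟨h.1.lt₀₁.le, (h.1.lt₁₂.trans h.1.lt₂₃).le⟩).2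
  have hit : ∀ k, (fun x => H (-f x))^[k] c₂ = altOrbit f c₂ c₁ k := by
    intro k
    induction k with
    | zero => rw [altOrbit_zero]; rfl
    | succ k ih => rw [Function.iterate_succ_apply', ih, ← altOrbit_succ f, hHk]
  refine ⟨fun x => H (-f x), q, c₂, f c₁, ⟨hq.2, hc, fun x hx => ?_, ?_, ?_, ?_⟩, fun j => ?_⟩
  · have := h.1.apply_mem hq hfq hb hx
    constructor
    · rw [← hHq]; exact hHm.monotone (neg_le_neg this.2)
    · rw [← hHmax]; exact hHm.monotone (neg_le_neg this.1)
  · exact hHc.comp_continuousOn (h.1.continuousOn.mono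
      (Set.Icc_subset_Icc (h.1.lt₀₁.trans hq.1).le hf3)).neg
  · intro x hx y hy hxy
    exact hHm (neg_lt_neg (h.1.decr_middle ⟨hq.1.le.trans hx.1, hx.2⟩
      ⟨hq.1.le.trans hy.1, hy.2⟩ hxy))
  · intro x hx y hy hxy
    exact hHm (neg_lt_neg (h.1.incr_right ⟨hx.1, hx.2.trans hf3⟩ ⟨hy.1, hy.2.trans hf3⟩ hxy))
  · rw [hit, ← hfold.addr true j]
    simp only [foldedOrbit, altOrbit_zero]

/-! ### Markov matrices -/

theorem URealizedBy.transitionMatrix_eq {P : List ULap} {g : ℝ → ℝ} {b₀ c b₁ : ℝ}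
    (h : URealizedBy P g b₀ c b₁) {n : ℕ} {κ : Fin (n + 1) → ℕ} {τ : Fin (n + 1) → Fin (n + 1)}
    (hκ : StrictMono fun i => g^[κ i] c) (hsurj : ∀ k, ∃ i, g^[k] c = g^[κ i] c)
    (hτ : ∀ i, g^[κ i + 1] c = g^[κ (τ i)] c) :
    IsEnumeration (fun i => g^[κ i] c) (orbit g c) ∧
      coverMatrix τ = transitionMatrix g fun i => g^[κ i] c := by
  refine ⟨⟨hκ, ?_⟩, ?_⟩
  · ext x
    constructor
    · rintro ⟨i, rfl⟩; exact ⟨κ i, rfl⟩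
    · rintro ⟨k, rfl⟩
      obtain ⟨i, hi⟩ := hsurj k
      exact ⟨i, hi.symm⟩
  · obtain ⟨k, hk⟩ := hsurj 0
    refine (transitionMatrix_eq_coverMatrix hκ
      (fun i => by rw [← hτ, Function.iterate_succ_apply']) (fun i => ?_) fun i => ?_).symm
    · exact h.1.continuousOn.mono
        (Set.Icc_subset_Icc (h.1.iterate_mem _).1 (h.1.iterate_mem _).2)
    · rcases le_castSucc_or_succ_le hκ k i with H | H <;> rw [← hk] at H
      · exact Or.inr (h.1.decr_right.antitoneOn.mono
          (Set.Icc_subset_Icc H (h.1.iterate_mem _).2))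
      · exact Or.inl (h.1.incr_left.monotoneOn.mono
          (Set.Icc_subset_Icc (h.1.iterate_mem _).1 H))

/-- The sequence that runs through `w` backwards and then through `w'`. -/
def mirrorAppend {n : ℕ} (w w' : Fin (n + 1) → ℝ) (k : Fin (2 * n + 1 + 1)) : ℝ :=
  if (k : ℕ) ≤ n then w ⟨n - k, by omega⟩ else w' ⟨k - (n + 1), by omega⟩

section mirrorAppend
variable {n : ℕ} {w w' : Fin (n + 1) → ℝ}

theorem mirrorAppend_left {k : Fin (2 * n + 1 + 1)} (i : Fin (n + 1)) (h : (k : ℕ) + i = n) :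
    mirrorAppend w w' k = w i := by
  have : (⟨n - k, by omega⟩ : Fin (n + 1)) = i := Fin.ext (by simp; omega)
  simp [mirrorAppend, show (k : ℕ) ≤ n by omega, this]

theorem mirrorAppend_right {k : Fin (2 * n + 1 + 1)} (i : Fin (n + 1)) (h : (k : ℕ) = n + 1 + i) :
    mirrorAppend w w' k = w' i := by
  have : (⟨k - (n + 1), by omega⟩ : Fin (n + 1)) = i := Fin.ext (by simp; omega)
  simp [mirrorAppend, show ¬ (k : ℕ) ≤ n by omega, this]

theorem strictMono_mirrorAppend (hw : StrictAnti w) (hw' : StrictMono w')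
    (h : ∀ i j, w i < w' j) : StrictMono (mirrorAppend w w') := by
  intro k l hkl
  have hkl' : (k : ℕ) < l := hkl
  unfold mirrorAppend
  split_ifs with h1 h2
  · exact hw (Fin.lt_def.2 (by simp; omega))
  · exact h _ _
  · omega
  · exact hw' (Fin.lt_def.2 (by simp; omega))

theorem mirrorAppend_image_left : mirrorAppend w w' '' {k | (k : ℕ) ≤ n} = Set.range w := by
  ext x
  constructor
  · rintro ⟨k, hk, rfl⟩
    have hk' : (k : ℕ) ≤ n := hk
    exact ⟨⟨n - k, by omega⟩, (mirrorAppend_left _ (by simp; omega)).symm⟩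
  · rintro ⟨i, rfl⟩
    exact ⟨⟨n - i, by omega⟩, by simp, mirrorAppend_left i (by simp; omega)⟩

theorem mirrorAppend_image_right : mirrorAppend w w' '' {k | n < (k : ℕ)} = Set.range w' := by
  ext x
  constructor
  · rintro ⟨k, hk, rfl⟩
    have hk' : n < (k : ℕ) := hk
    exact ⟨⟨k - (n + 1), by omega⟩, (mirrorAppend_right _ (by simp; omega)).symm⟩
  · rintro ⟨i, rfl⟩
    exact ⟨⟨n + 1 + i, by omega⟩, by simp; omega, mirrorAppend_right i (by simp)⟩

theorem range_mirrorAppend : Set.range (mirrorAppend w w') = Set.range w ∪ Set.range w' := by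
  rw [← mirrorAppend_image_left (w := w) (w' := w'), ← mirrorAppend_image_right (w := w),
    ← Set.image_union, ← Set.image_univ]
  congr 1
  ext k
  simpa using le_or_gt (k : ℕ) n

theorem apply_mirrorAppend {f : ℝ → ℝ} {τ : Fin (n + 1) → Fin (n + 1)}
    (h : ∀ i, f (w i) = w' (τ i)) (h' : ∀ i, f (w' i) = w (τ i)) (k : Fin (2 * n + 1 + 1)) :
    f (mirrorAppend w w' k) = mirrorAppend w w' (swapMap τ k) := by
  rcases le_or_gt (k : ℕ) n with hk | hk
  · have e : (k : ℕ) + (⟨n - k, by omega⟩ : Fin (n + 1)) = n := by simp; omega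
    rw [mirrorAppend_left _ e, mirrorAppend_right _ (swapMap_left τ _ e), h]
  · have e : (k : ℕ) = n + 1 + (⟨k - (n + 1), by omega⟩ : Fin (n + 1)) := by simp; omega
    rw [mirrorAppend_right _ e, mirrorAppend_left (τ ⟨k - (n + 1), by omega⟩)
      (by rw [swapMap_right τ _ e]; omega), h']

end mirrorAppend

theorem Data.RealizedBy.isEnumeration_and {S : Data} {f : ℝ → ℝ} {c₀ c₁ c₂ c₃ : ℝ}
    (h : S.RealizedBy f c₀ c₁ c₂ c₃) (h1 : SeqLT seqM S.seq) (h2 : SeqLT S.seq seqRM) {n : ℕ}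
    {κ : Fin (n + 1) → ℕ} {τ : Fin (n + 1) → Fin (n + 1)}
    (hκ : ∀ r, IsFolded S.unimodal r → ∀ a, StrictMono (fun i => r a (κ i)) ∧
      (∀ k, ∃ i, ∀ b, r b k = r b (κ i)) ∧ ∀ i, r a (κ i + 1) = r a (κ (τ i))) :
    ∃ z : Fin (2 * n + 1 + 1) → ℝ, IsEnumeration z (orbit f c₁ ∪ orbit f c₂) ∧
      coverMatrix (swapMap τ) = transitionMatrix f z ∧
      z '' {k | (k : ℕ) ≤ n} = evenOrbit f c₁ ∪ oddOrbit f c₂ ∧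
      z '' {k | n < (k : ℕ)} = oddOrbit f c₁ ∪ evenOrbit f c₂ := by
  obtain ⟨q, hq, hfq, hb, hR, hL, hfold⟩ := h.exists_isFolded h1 h2
  obtain ⟨hmR, hs, htR⟩ := hκ _ hfold true
  obtain ⟨hmL, -, htL⟩ := hκ _ hfold false
  simp only [foldedOrbit, neg_inj] at hmR hmL htR htL
  set w : Fin (n + 1) → ℝ := fun i => altOrbit f c₁ c₂ (κ i) with hw
  set w' : Fin (n + 1) → ℝ := fun i => altOrbit f c₂ c₁ (κ i) with hw'
  have hrL : Set.range w = Set.range (altOrbit f c₁ c₂) := by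
    ext x
    constructor
    · rintro ⟨i, rfl⟩; exact ⟨κ i, rfl⟩
    · rintro ⟨k, rfl⟩
      obtain ⟨i, hi⟩ := hs k
      exact ⟨i, (neg_inj.1 (hi false)).symm⟩
  have hrR : Set.range w' = Set.range (altOrbit f c₂ c₁) := by
    ext x
    constructor
    · rintro ⟨i, rfl⟩; exact ⟨κ i, rfl⟩
    · rintro ⟨k, rfl⟩
      obtain ⟨i, hi⟩ := hs k
      exact ⟨i, (hi true).symm⟩
  have hz : StrictMono (mirrorAppend w w') :=
    strictMono_mirrorAppend (fun i j hij => neg_lt_neg_iff.1 (hmL hij)) hmR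
      fun i j => (hL _).2.trans (hR _).1
  have hzr : Set.range (mirrorAppend w w') = orbit f c₁ ∪ orbit f c₂ := by
    rw [range_mirrorAppend, hrL, hrR, orbit_union_orbit]
  have hmem : ∀ k, mirrorAppend w w' k ∈ Set.Icc c₀ c₃ := by
    intro k
    have : mirrorAppend w w' k ∈ orbit f c₁ ∪ orbit f c₂ := hzr ▸ Set.mem_range_self k
    rcases this with ⟨j, hj⟩ | ⟨j, hj⟩ <;> rw [← hj]
    · exact h.1.mapsTo.iterate j ⟨h.1.lt₀₁.le, (h.1.lt₁₂.trans h.1.lt₂₃).le⟩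
    · exact h.1.mapsTo.iterate j ⟨(h.1.lt₀₁.trans h.1.lt₁₂).le, h.1.lt₂₃.le⟩
  refine ⟨mirrorAppend w w', ⟨hz, hzr⟩, ?_, ?_, ?_⟩
  -- Both turning points are division points, so each interval lies in a single lap and `f` is
  -- monotone on it.
  · obtain ⟨k₁, hk₁⟩ : c₁ ∈ Set.range (mirrorAppend w w') := hzr ▸ Or.inl ⟨0, rfl⟩
    obtain ⟨k₂, hk₂⟩ : c₂ ∈ Set.range (mirrorAppend w w') := hzr ▸ Or.inr ⟨0, rfl⟩
    refine (transitionMatrix_eq_coverMatrix hz (apply_mirrorAppend (fun i => ?_) fun i => ?_)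
      (fun i => ?_) fun i => ?_).symm
    · simp only [hw, hw']; rw [← altOrbit_succ f, htR]
    · simp only [hw, hw']; rw [← altOrbit_succ f, htL]
    · exact h.1.continuousOn.mono (Set.Icc_subset_Icc (hmem _).1 (hmem _).2)
    · have H₁ := le_castSucc_or_succ_le hz k₁ i
      have H₂ := le_castSucc_or_succ_le hz k₂ i
      rw [hk₁] at H₁
      rw [hk₂] at H₂
      rcases H₁ with H₁ | H₁
      · rcases H₂ with H₂ | H₂
        · exact Or.inl (h.1.incr_right.monotoneOn.mono (Set.Icc_subset_Icc H₂ (hmem _).2))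
        · exact Or.inr (h.1.decr_middle.antitoneOn.mono (Set.Icc_subset_Icc H₁ H₂))
      · exact Or.inl (h.1.incr_left.monotoneOn.mono (Set.Icc_subset_Icc (hmem _).1 H₁))
  · rw [mirrorAppend_image_left, hrL, range_altOrbit]
  · rw [mirrorAppend_image_right, hrR, range_altOrbit, Set.union_comm]

/-- The leftmost point of a folded orbit of period at least two is not fixed. -/
theorem IsFolded.tau_zero_ne {P : List ULap} {r : Bool → ℕ → ℝ} (h : IsFolded P r) {n : ℕ}
    (hn : n = P.length) (h1 : 1 ≤ n) {κ : Fin (n + 1) → ℕ} {τ : Fin (n + 1) → Fin (n + 1)}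
    (hτ : ∀ i, r true (κ i + 1) = r true (κ (τ i))) : τ 0 ≠ 0 := by
  intro e
  have h2 := hτ 0
  rw [e] at h2
  -- Adding `P.length * κ 0` makes the index `κ 0` a multiple of the period and `κ 0 + 1` congruent
  -- to `1`; a fixed leftmost point would make the turning point fixed.
  have h3 := h.add_eq true h2 (P.length * κ 0)
  rw [show κ 0 + P.length * κ 0 = (P.length + 1) * κ 0 by ring,
    h.eq_zero_of_dvd true (dvd_mul_right _ _),
    show κ 0 + 1 + P.length * κ 0 = 1 + (P.length + 1) * κ 0 by ring, ← h.mod_eq true,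
    Nat.add_mul_mod_self_left, Nat.mod_eq_of_lt (by omega)] at h3
  exact h.ne_zero true one_pos (by omega) h3

end SymBimodal

/-! ### Proof of the proposition: one realizing map determines `κ` and `τ` for all. -/

theorem proposition1 (S : SymBimodal.Data) (hS : S ∈ SymBimodal.setD₁) (n : ℕ)
    (hn : n = S.word.length) :
    S.unimodal ∈ SymBimodal.setT ∧
    (∃ (AS : Matrix (Fin (2 * n + 1)) (Fin (2 * n + 1)) ℤ) (AP : Matrix (Fin n) (Fin n) ℤ)
      (W₁ W₂ : Matrix Unit (Fin n) ℤ),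
      S.IsMarkovMatrix AS ∧
      SymBimodal.UIsMarkovMatrix S.unimodal AP ∧
      AS.submatrix (SymBimodal.blockEquiv n) (SymBimodal.blockEquiv n) =
        Matrix.fromBlocks 1 (Matrix.fromCols W₁ W₂) 0 (Matrix.fromBlocks 0 AP AP 0) ∧
      (1 ≤ n → W₁ ≠ 0 ∧ W₂ ≠ 0)) ∧
    (∀ (f : ℝ → ℝ) (c₀ c₁ c₂ c₃ : ℝ), S.RealizedBy f c₀ c₁ c₂ c₃ →
      ∀ z : Fin (2 * n + 1 + 1) → ℝ,
        SymBimodal.IsEnumeration z (SymBimodal.orbit f c₁ ∪ SymBimodal.orbit f c₂) →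
        z '' {k | (k : ℕ) ≤ n} = SymBimodal.evenOrbit f c₁ ∪ SymBimodal.oddOrbit f c₂ ∧
        z '' {k | n < (k : ℕ)} = SymBimodal.oddOrbit f c₁ ∪ SymBimodal.evenOrbit f c₂) := by
  obtain ⟨hD, h1, h2⟩ := hS
  obtain ⟨f, c₀, c₁, c₂, c₃, hf⟩ := id hD
  obtain ⟨q, -, -, -, -, -, hfold⟩ := hf.exists_isFolded h1 h2
  have hlen : n = S.unimodal.length := by rw [SymBimodal.Data.unimodal, List.length_map, hn]
  obtain ⟨κ, τ, hκ⟩ := hfold.exists_enumeration hlen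
  have hT := hf.unimodal_mem_setT h1 h2
  refine ⟨hT, ⟨SymBimodal.coverMatrix (SymBimodal.swapMap τ), SymBimodal.coverMatrix τ,
    SymBimodal.middleRow τ, SymBimodal.middleRow τ, ⟨hD, ?_⟩, ⟨hT, ?_⟩,
    SymBimodal.coverMatrix_swapMap τ, fun hn1 => ?_⟩, ?_⟩
  · intro f c₀ c₁ c₂ c₃ h
    obtain ⟨z, hz, hA, -⟩ := h.isEnumeration_and h1 h2 hκ
    exact ⟨z, hz, hA⟩
  · intro g b₀ c b₁ h
    obtain ⟨hm, hs, ht⟩ := hκ _ h.isFolded true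
    refine ⟨_, h.transitionMatrix_eq hm (fun k => ?_) ht⟩
    obtain ⟨i, hi⟩ := hs k
    exact ⟨i, hi true⟩
  · have h0 := hfold.tau_zero_ne hlen hn1 (hκ _ hfold true).2.2
    exact ⟨SymBimodal.middleRow_ne_zero hn1 h0, SymBimodal.middleRow_ne_zero hn1 h0⟩
  · intro f c₀ c₁ c₂ c₃ h z hz
    obtain ⟨z', hz', -, hl, hr⟩ := h.isEnumeration_and h1 h2 hκ
    -- A strictly increasing enumeration is determined by its range.
    obtain rfl : z = z' := (hz.1.range_inj hz'.1).1 (hz.2.trans hz'.2.symm)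
    exact ⟨hl, hr⟩
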